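/- Let $R$ be a Noetherian normal domain, let $B$ be an $R$-algebra isomorphic to a polynomial ring $R[X_1,\dots,X_n]$ in finitely many variables, and let $A$ be an $R$-subalgebra of $B$. Call $A$ a retract of $B$ if there is a ring endomorphism $\pi: B\to B$ with $\pi^2=\pi$ and $\pi(B)=A$. An exponential map on $B$ over $A$ is an $A$-algebra homomorphism $\phi=\phi_U: B\to B[U]$ such that (a) $\phi$ followed by evaluation at $U=0$ is the identity of $B$, and (b) $\phi_V\phi_U=\phi_{V+U}$ as maps $B\to B[V,U]$, where $\phi_V$ is extended to $B[U]\to B[V,U]$ by $\phi_V(U)=U$. It is nontrivial if it is not the inclusion $B\subset B[U]$, and its ring of invariants is $B^\phi=\{b\in B : \phi(b)=b\}$. Then the following are equivalent: (I) $A$ is a retract of $B$ and $A=B^\phi$ for some nontrivial exponential map $\phi$ on $B$ over $A$. (II) There is an invertible ideal $I$ of $R$ such that $B\cong \operatorname{Sym}_A(IA)$ as $A$-algebras, where $\operatorname{Sym}_A(IA)$ is the symmetric algebra of the $A$-module $IA$. If moreover $R$ contains $\mathbb{Q}$, then (II) is also equivalent to: (I') $A$ is a retract of $B$ and $A=\ker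 D$ for some nonzero locally nilpotent $R$-derivation $D$ of $B$ (that is, for each $b\in B$ there is $m\ge 1$ with $D^m(b)=0$). -/

import Mathlib

open scoped Polynomial nonZeroDivisors

namespace GaAction

/-- A subring `A` of a ring `B` is a retract of `B` if it is the image of an idempotent ring
endomorphism of `B`. -/
def IsRetract {B : Type*} [CommRing B] (A : Subring B) : Prop :=
  ∃ π : B →+* B, π.comp π = π ∧ π.range = A

/-- A `k`-algebra homomorphism `φ = φ_U : B → B[U]` is an exponential map if
evaluation at `U = 0` after `φ` is the identity and `φ_V φ_U = φ_{V+U}`.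
The ring `B[V, U]` is written as `B[V][U]`: the inner variable `V` is `C X` and the outer variable
`U` is `X`. The extension of `φ_V` to `B[U] → B[V][U]` with `U ↦ U` is `Polynomial.map φ`, and
`φ_{V+U}` is `φ` followed by the substitution of `V + U` for the variable. -/
structure IsExponentialMap {k B : Type*} [CommRing k] [CommRing B] [Algebra k B]
    (φ : B →ₐ[k] B[X]) : Prop where
  eval_zero : ∀ b : B, (φ b).eval 0 = b
  map_map : ∀ b : B, (φ b).map (φ : B →+* B[X]) =
    (φ b).eval₂ ((Polynomial.C : B[X] →+* B[X][X]).comp (Polynomial.C : B →+* B[X]))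
      (Polynomial.C Polynomial.X + Polynomial.X)

/-- The trivial exponential map: the inclusion of `B` in `B[U]` as the constants. -/
noncomputable def trivialMap (k B : Type*) [CommRing k] [CommRing B] [Algebra k B] :
    B →ₐ[k] B[X] :=
  (Polynomial.CAlgHom : B →ₐ[B] B[X]).restrictScalars k

/-- The ring of invariants `B^φ = {b ∈ B | φ b = b}`. -/
noncomputable def invariants {k B : Type*} [CommRing k] [CommRing B] [Algebra k B]
    (φ : B →ₐ[k] B[X]) : Subring B :=
  RingHom.eqLocus (φ : B →+* B[X]) (Polynomial.C : B →+* B[X])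

/-- A derivation `D` of `B` is locally nilpotent if every element of `B` is annihilated by some
positive power of `D`. -/
def IsLocallyNilpotent {k B : Type*} [CommRing k] [CommRing B] [Algebra k B]
    (D : Derivation k B B) : Prop :=
  ∀ b : B, ∃ m : ℕ, 0 < m ∧ (⇑D)^[m] b = 0

/-- For an `R`-subalgebra `A` of `B`: there are an invertible ideal `I` of the domain `R` and an
isomorphism of `A`-algebras from `B` to the symmetric algebra of the `A`-module `IA`. -/
def IsSymOfInvertibleIdeal {R B : Type*} [CommRing R] [IsDomain R] [CommRing B] [Algebra R B]
    (A : Subalgebra R B) : Prop :=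
  ∃ I : Ideal R, IsUnit (I : FractionalIdeal R⁰ (FractionRing R)) ∧
    Nonempty (B ≃ₐ[A] SymmetricAlgebra A (I.map (algebraMap R A)))

end GaAction

/-! From (I) to (II): composing the action `φ` coefficientwise with a retraction `π : B → A` gives
an `A`-algebra map `ψ : B → A[X]`. It is injective, because the leading coefficient of `φ b` is
invariant, hence lies in `A` and is fixed by `π`. For a locally nilpotent derivation, `ψ b = ∑ π (Dⁱ
b) / i! Xⁱ` plays the same role. From here on only `π`, `ψ` and `A ≠ B` matter.

Since `A[X]` has transcendence degree one over `A`, the extension of `ker π` to the polynomial ring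
over `K = Frac R` is generated by one prime, which may be taken as some `u ∈ ker π`
(`exists_prime_generator`). Gauss's lemma over `R` refines this to `ker π = (u / x₀) I B`, where
`x₀` is a nonzero coefficient of `u` and `I = {x ∈ R | x u ∈ x₀ B}`. A basis of `B` over `R` and an
augmentation `B → R` show that `I` is invertible (`exists_mul_eq_span_of_ker_eq`). Induction on the
degree of `ψ b` shows that `(u / x₀) I` generates `B` over `A` (`mem_smul_of_mem_smul_top`); there
are no extra relations because `u` is transcendental over `A`.

Conversely, the symmetric algebra of `J = IA` embeds into `A[X]` by `x ↦ x X`. The augmentation is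
the retraction, `x ↦ x + x U` is the action, and its `U`-coefficient is the derivation, which
becomes `d/dX` in `A[X]`. -/

namespace GaAction

/-! ### Gauss's lemma over valuation rings and integrally closed domains. -/

section Gauss

/-- A nonzero polynomial over a field has, for every valuation subring `V`, a nonzero scalar
multiple with coefficients in `V` and some coefficient equal to one. -/
theorem exists_normalization {σ K : Type*} [Field K] (V : ValuationSubring K)
    (f : MvPolynomial σ K) (hf : f ≠ 0) :
    ∃ (a : σ →₀ ℕ) (f' : MvPolynomial σ V), f.coeff a ≠ 0 ∧ f'.coeff a = 1 ∧
      f = MvPolynomial.C (f.coeff a) * f'.map (algebraMap V K) ∧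
      ∀ m, ∃ v : V, f.coeff m = v * f.coeff a := by
  -- Dividing by a coefficient of largest valuation puts all coefficients in `V`.
  obtain ⟨a, ha, hmax⟩ := f.support.exists_max_image (fun m ↦ V.valuation (f.coeff m))
    (MvPolynomial.support_nonempty.mpr hf)
  have ha0 : f.coeff a ≠ 0 := MvPolynomial.mem_support_iff.mp ha
  have hmem : ∀ m, f.coeff m / f.coeff a ∈ V := by
    intro m
    by_cases hm : m ∈ f.support
    · rw [← V.valuation_le_one_iff, map_div₀]
      exact div_le_one_of_le₀ (hmax m hm) zero_le
    · rw [MvPolynomial.notMem_support_iff.mp hm, zero_div]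
      exact V.zero_mem
  have hr : MvPolynomial.C (f.coeff a)⁻¹ * f ∈
      Set.range (MvPolynomial.map (σ := σ) (algebraMap V K)) := by
    rw [MvPolynomial.mem_range_map_iff_coeffs_subset]
    intro c hc
    obtain ⟨m, -, rfl⟩ := MvPolynomial.mem_coeffs_iff.mp hc
    refine ⟨⟨_, hmem m⟩, ?_⟩
    rw [MvPolynomial.coeff_C_mul]
    exact div_eq_inv_mul _ _
  obtain ⟨f', hf'⟩ := hr
  refine ⟨a, f', ha0, ?_, ?_, ?_⟩
  · apply IsFractionRing.injective V K
    rw [← MvPolynomial.coeff_map, hf', MvPolynomial.coeff_C_mul, inv_mul_cancel₀ ha0, map_one]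
  · change _ = _ * MvPolynomial.map (algebraMap V K) f'
    rw [hf', ← mul_assoc, ← MvPolynomial.C_mul, mul_inv_cancel₀ ha0, MvPolynomial.C_1, one_mul]
  · exact fun m ↦ ⟨⟨_, hmem m⟩, (div_mul_cancel₀ _ ha0).symm⟩

/-- **Gauss's lemma** for a valuation ring: if the coefficients of `f * g` lie in `V`, so do the
products of the coefficients of `f` and `g`. -/
theorem coeff_mul_coeff_mem_valuationSubring {σ K : Type*} [Field K] (V : ValuationSubring K)
    (f g : MvPolynomial σ K) (h : ∀ m, (f * g).coeff m ∈ V) (i j : σ →₀ ℕ) :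
    f.coeff i * g.coeff j ∈ V := by
  rcases eq_or_ne f 0 with rfl | hf
  · simp
  rcases eq_or_ne g 0 with rfl | hg
  · simp
  obtain ⟨a, f', ha0, hfa, hff', hfm⟩ := exists_normalization V f hf
  obtain ⟨b, g', hb0, hgb, hgg', hgm⟩ := exists_normalization V g hg
  suffices hab : f.coeff a * g.coeff b ∈ V by
    obtain ⟨v, hv⟩ := hfm i
    obtain ⟨w, hw⟩ := hgm j
    rw [hv, hw, mul_mul_mul_comm]
    exact V.mul_mem _ _ (V.mul_mem _ _ v.2 w.2) hab
  have hne : ∀ (q : MvPolynomial σ V) (c : σ →₀ ℕ), q.coeff c = 1 →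
      q.map (IsLocalRing.residue V) ≠ 0 := by
    intro q c hc h0
    have := congrArg (MvPolynomial.coeff c) h0
    rw [MvPolynomial.coeff_map, hc, map_one, MvPolynomial.coeff_zero] at this
    exact one_ne_zero this
  -- Polynomials over the residue field form a domain, so some coefficient of `f' * g'` is a unit of
  -- `V`; up to that unit, `f.coeff a * g.coeff b` is a coefficient of `f * g`.
  have hprod : (f' * g').map (IsLocalRing.residue V) ≠ 0 := by
    rw [map_mul]
    exact mul_ne_zero (hne f' a hfa) (hne g' b hgb)
  obtain ⟨k, hk⟩ := MvPolynomial.ne_zero_iff.mp hprod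
  rw [MvPolynomial.coeff_map, IsLocalRing.residue_ne_zero_iff_isUnit] at hk
  obtain ⟨t, ht⟩ := hk
  have hfg : (f * g).coeff k = f.coeff a * g.coeff b * ((f' * g').coeff k : V) := by
    conv_lhs => rw [hff', hgg', mul_mul_mul_comm, ← MvPolynomial.C_mul, ← map_mul,
      MvPolynomial.coeff_C_mul, MvPolynomial.coeff_map]
    rfl
  have htu : ((t : V) : K) * ((t⁻¹ : Vˣ) : V) = 1 := by
    exact_mod_cast congrArg (Subtype.val) t.mul_inv
  have : f.coeff a * g.coeff b = (f * g).coeff k * (((t⁻¹ : Vˣ) : V) : K) := by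
    rw [hfg, ← ht, mul_assoc, htu, mul_one]
  rw [this]
  exact V.mul_mem _ _ (h k) (Subtype.property _)

/-- **Gauss's lemma** for an integrally closed domain: if `f * g` has coefficients in `R`, then so
have the products of the coefficients of `f` and `g`. -/
theorem coeff_mul_coeff_mem_of_isIntegrallyClosed {σ R K : Type*} [CommRing R] [IsDomain R]
    [IsIntegrallyClosed R] [Field K] [Algebra R K] [IsFractionRing R K]
    (f g : MvPolynomial σ K) (h : ∀ m, (f * g).coeff m ∈ (algebraMap R K).range)
    (i j : σ →₀ ℕ) : f.coeff i * g.coeff j ∈ (algebraMap R K).range := by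
  have hcl : IsIntegrallyClosedIn (algebraMap R K).range K := by
    have h1 : IsIntegrallyClosedIn R K := inferInstance
    rw [isIntegrallyClosedIn_iff] at h1 ⊢
    refine ⟨Subtype.val_injective, fun {x} hx ↦ ?_⟩
    have : IsIntegral R x := by
      obtain ⟨p, hp, hpx⟩ := hx
      have hs := (algebraMap R K).rangeRestrict_surjective
      obtain ⟨q, hq, -, hqm⟩ := Polynomial.lifts_and_degree_eq_and_monic
        (f := (algebraMap R K).rangeRestrict) (p := p)
        ((Polynomial.mem_lifts _).mpr (Polynomial.map_surjective _ hs p)) hp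
      refine ⟨q, hqm, ?_⟩
      rw [← hpx, ← hq, Polynomial.eval₂_map]
      rfl
    obtain ⟨y, rfl⟩ := h1.2 this
    exact ⟨⟨_, y, rfl⟩, rfl⟩
  -- An integrally closed subring of a field is the intersection of the valuation subrings
  -- containing it, which reduces the claim to valuation rings.
  rw [Subring.eq_iInf_of_isIntegrallyClosedIn (R := (algebraMap R K).range)]
  simp only [Subring.mem_iInf]
  intro V
  exact coeff_mul_coeff_mem_valuationSubring V.1 f g (fun m ↦ V.2 (h m)) i j

end Gauss

/-! ### The kernel of the retraction, over `Frac R` and then over `R`. -/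

section HeightOne

/-- Two elements of an algebra that embeds into a polynomial ring in one variable satisfy a
nontrivial polynomial relation. -/
theorem exists_relation_of_injective {A B : Type*} [CommRing A] [IsDomain A] [CommRing B]
    [Algebra A B] (ψ : B →ₐ[A] A[X]) (hψ : Function.Injective ψ) (b p : B) :
    ∃ F : A[X][X], F ≠ 0 ∧ F.eval₂ (Polynomial.aeval p : A[X] →ₐ[A] B).toRingHom b = 0 := by
  have hdep : ¬ AlgebraicIndependent A ![ψ b, ψ p] := by
    intro h
    have := h.lift_cardinalMk_le_trdeg
    rw [Polynomial.trdeg_of_isDomain] at this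
    simp at this
  rw [algebraicIndependent_iff] at hdep
  push Not at hdep
  obtain ⟨G, hG, hG0⟩ := hdep
  -- The outer variable stands for `b`, the inner one for `p`.
  let e := (MvPolynomial.finSuccEquiv A 1).trans
    (Polynomial.mapAlgEquiv (MvPolynomial.uniqueAlgEquiv A (Fin 1)))
  refine ⟨e G, by simpa using hG0, hψ ?_⟩
  let ev : A[X][X] →+* B :=
    Polynomial.eval₂RingHom (Polynomial.aeval p : A[X] →ₐ[A] B).toRingHom b
  have key : ((ψ : B →+* A[X]).comp ev).comp (e : MvPolynomial (Fin 2) A →+* A[X][X]) =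
      (MvPolynomial.aeval ![ψ b, ψ p] : MvPolynomial (Fin 2) A →ₐ[A] A[X]) := by
    apply MvPolynomial.ringHom_ext
    · intro a
      simp [e, ev, MvPolynomial.finSuccEquiv_apply]
    · intro i
      have h1 : MvPolynomial.finSuccEquiv A 1 (MvPolynomial.X 1) =
          Polynomial.C (MvPolynomial.X 0) := MvPolynomial.finSuccEquiv_X_succ (j := 0)
      fin_cases i
      · simp [e, ev, MvPolynomial.finSuccEquiv_apply]
      · simp [e, ev, h1]
  have := DFunLike.congr_fun key G
  rw [map_zero]
  exact this.trans hG

/-- Let `B` embed into `A[X]` and retract to `A` by `π`. If an element `b` becomes prime in an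
overring `S` of `B` and the multiples of `b` in `S` that lie in `B` are killed by `π`, then `ker π`
consists of such multiples. -/
theorem dvd_of_map_eq_zero {A B S : Type*} [CommRing A] [IsDomain A] [CommRing B]
    [Algebra A B] (ψ : B →ₐ[A] A[X]) (hψ : Function.Injective ψ) (π : B →ₐ[A] A)
    [CommRing S] [IsDomain S] (ρ : B →+* S) (b : B) (hb : Prime (ρ b))
    (hbπ : ∀ c, ρ b ∣ ρ c → π c = 0) (p : B) (hp : π p = 0) : ρ b ∣ ρ p := by
  by_contra hdvd
  let ev : A[X] →+* S := ρ.comp (Polynomial.aeval p : A[X] →ₐ[A] B).toRingHom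
  -- If `b` divides `G(p)`, primality allows powers of `p` to be removed until `G` has nonzero
  -- constant term; applying `π` kills `p` and leaves that constant term equal to zero.
  have hconst : ∀ G : A[X], G ≠ 0 → ¬ ρ b ∣ ev G := by
    intro G hG hGd
    obtain ⟨k, G', hG', hG0⟩ : ∃ (k : ℕ) (G' : A[X]), G = Polynomial.X ^ k * G' ∧
        G'.coeff 0 ≠ 0 := by
      obtain ⟨G', h1, h2⟩ := Polynomial.exists_eq_pow_rootMultiplicity_mul_and_not_dvd G hG 0
      rw [map_zero, sub_zero] at h1 h2
      exact ⟨_, G', h1, by rwa [Polynomial.X_dvd_iff] at h2⟩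
    have hX : ev Polynomial.X = ρ p := by simp [ev]
    rw [hG', map_mul, map_pow, hX] at hGd
    rcases hb.dvd_or_dvd hGd with h | h
    · exact hdvd (hb.dvd_of_dvd_pow h)
    · have := hbπ (Polynomial.aeval p G') h
      rw [← Polynomial.aeval_algHom_apply, hp, ← Polynomial.coeff_zero_eq_aeval_zero] at this
      exact hG0 (by simpa using this)
  obtain ⟨F, hF, hF0⟩ := exists_relation_of_injective ψ hψ b p
  -- With powers of `b` cancelled from the relation, its constant term in `b` is a nonzero
  -- polynomial in `p` divisible by `b`, contrary to `hconst`.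
  obtain ⟨F', h1, h2⟩ := Polynomial.exists_eq_pow_rootMultiplicity_mul_and_not_dvd F hF 0
  rw [map_zero, sub_zero] at h1 h2
  rw [Polynomial.X_dvd_iff] at h2
  have hev : F'.eval₂ ev (ρ b) = 0 := by
    have h3 : F.eval₂ ev (ρ b) = 0 := by
      have := congrArg ρ hF0
      rwa [Polynomial.hom_eval₂, map_zero] at this
    rw [h1, Polynomial.eval₂_mul, Polynomial.eval₂_pow, Polynomial.eval₂_X] at h3
    exact (mul_eq_zero.mp h3).resolve_left (pow_ne_zero _ hb.ne_zero)
  refine hconst _ h2 ?_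
  have h4 := Polynomial.divX_mul_X_add F'
  rw [← h4, Polynomial.eval₂_add, Polynomial.eval₂_mul, Polynomial.eval₂_X,
    Polynomial.eval₂_C] at hev
  rw [eq_neg_of_add_eq_zero_right hev]
  exact (Dvd.intro_left _ rfl).neg_right

/-- The kernel of a retraction of a polynomial ring `B` over `R` to a subring `A` such that `B`
embeds into `A[X]` becomes principal over the field of fractions of `R`. -/
theorem exists_prime_generator {σ R A B : Type*} [CommRing R] [IsDomain R] [CommRing A]
    [IsDomain A] [CommRing B] [Algebra R A] [Algebra A B] [Algebra R B] [IsScalarTower R A B]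
    [FaithfulSMul R A] (K : Type*) [Field K] [Algebra R K] [IsFractionRing R K]
    (e : B ≃ₐ[R] MvPolynomial σ R) (ψ : B →ₐ[A] A[X]) (hψ : Function.Injective ψ)
    (π : B →ₐ[A] A) (hπ : ∃ p, p ≠ 0 ∧ π p = 0) :
    ∃ b : B, Prime ((e b).map (algebraMap R K)) ∧ π b = 0 ∧
      ∀ p, π p = 0 → (e b).map (algebraMap R K) ∣ (e p).map (algebraMap R K) := by
  let := MvPolynomial.algebraMvPolynomial (σ := σ) (R := R) (S := K)
  have := MvPolynomial.isLocalization (σ := σ) R⁰ K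
  let M : Submonoid (MvPolynomial σ R) := R⁰.map (MvPolynomial.C (σ := σ))
  let π' : MvPolynomial σ R →+* A := (π : B →+* A).comp (e.symm : MvPolynomial σ R →+* B)
  have hπC : ∀ r, π' (MvPolynomial.C r) = algebraMap R A r := by
    intro r
    have : e.symm (MvPolynomial.C r) = algebraMap A B (algebraMap R A r) := by
      rw [← IsScalarTower.algebraMap_apply]
      exact e.symm.commutes r
    change π (e.symm _) = _
    rw [this, π.commutes]
    rfl
  let P : Ideal (MvPolynomial σ R) := RingHom.ker π'
  have hP : P.IsPrime := RingHom.ker_isPrime _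
  -- `π` is the identity on `R`, so its kernel misses the nonzero constants and its extension `Q`
  -- stays prime and contracts back to it.
  have hdis : Disjoint (M : Set (MvPolynomial σ R)) P := by
    rw [Set.disjoint_left]
    rintro _ ⟨r, hr, rfl⟩ h
    have h' : π' (MvPolynomial.C r) = 0 := h
    rw [hπC, FaithfulSMul.algebraMap_eq_zero_iff] at h'
    exact nonZeroDivisors.ne_zero hr h'
  let Q : Ideal (MvPolynomial σ K) := P.map (algebraMap _ _)
  have hQ : Q.IsPrime := IsLocalization.isPrime_of_isPrime_disjoint M _ P hP hdis
  have hQc : ∀ c, (e c).map (algebraMap R K) ∈ Q → π c = 0 := by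
    intro c hc
    have h1 : e c ∈ Ideal.under (MvPolynomial σ R)
        (P.map (algebraMap (MvPolynomial σ R) (MvPolynomial σ K))) := hc
    rw [IsLocalization.under_map_of_isPrime_disjoint M _ hP hdis] at h1
    have h2 : π (e.symm (e c)) = 0 := h1
    rwa [e.symm_apply_apply] at h2
  have hPQ : ∀ c, π c = 0 → (e c).map (algebraMap R K) ∈ Q := by
    intro c hc
    refine Ideal.mem_map_of_mem _ (?_ : e c ∈ P)
    change π (e.symm (e c)) = 0
    rwa [e.symm_apply_apply]
  have hinj : Function.Injective (MvPolynomial.map (σ := σ) (algebraMap R K)) :=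
    MvPolynomial.map_injective _ (IsFractionRing.injective R K)
  have hQ0 : Q ≠ ⊥ := by
    obtain ⟨p, hp0, hp⟩ := hπ
    intro h
    have := hPQ p hp
    rw [h, Ideal.mem_bot, ← map_zero (MvPolynomial.map (algebraMap R K))] at this
    exact hp0 (by simpa using hinj this)
  obtain ⟨q, hqQ, hq⟩ := hQ.exists_mem_prime_of_ne_bot hQ0
  -- Clearing denominators changes the prime `q` only by a unit and makes it come from `B`.
  obtain ⟨⟨c, m⟩, hcm⟩ := IsLocalization.surj M q
  have hm : IsUnit (algebraMap (MvPolynomial σ R) (MvPolynomial σ K) m) :=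
    IsLocalization.map_units _ m
  have hassoc : Associated q (MvPolynomial.map (algebraMap R K) c) :=
    ⟨hm.unit, by exact hcm⟩
  have heb : MvPolynomial.map (algebraMap R K) (e (e.symm c)) =
    MvPolynomial.map (algebraMap R K) c := by rw [e.apply_symm_apply]
  have hbp : Prime (MvPolynomial.map (algebraMap R K) (e (e.symm c))) := by
    rw [heb]; exact hassoc.prime hq
  have hbQ : MvPolynomial.map (algebraMap R K) (e (e.symm c)) ∈ Q := by
    rw [heb]; exact Q.mem_of_dvd hassoc.dvd hqQ
  refine ⟨e.symm c, hbp, hQc _ hbQ, fun p hp ↦ ?_⟩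
  exact dvd_of_map_eq_zero ψ hψ π
    ((MvPolynomial.map (algebraMap R K)).comp (e : B →+* MvPolynomial σ R)) (e.symm c) hbp
    (fun c hc ↦ hQc c (Q.mem_of_dvd hc hbQ)) p hp

/-- The kernel of a retraction of a polynomial ring over an integrally closed domain `R` to a
subring `A` such that `B` embeds into `A[X]` is, up to a factor `u / x₀`, extended from an ideal
of `R`. -/
theorem exists_ideal_generating_ker {σ R A B : Type*} [CommRing R] [IsDomain R]
    [IsIntegrallyClosed R] [CommRing A]
    [IsDomain A] [CommRing B] [Algebra R A] [Algebra A B] [Algebra R B] [IsScalarTower R A B]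
    [FaithfulSMul R A]
    (e : B ≃ₐ[R] MvPolynomial σ R) (ψ : B →ₐ[A] A[X]) (hψ : Function.Injective ψ)
    (π : B →ₐ[A] A) (hπ : ∃ p, p ≠ 0 ∧ π p = 0) :
    ∃ (I : Ideal R) (x₀ : R) (u : B), x₀ ∈ I ∧ x₀ ≠ 0 ∧ u ≠ 0 ∧ π u = 0 ∧
      (∀ x ∈ I, ∃ y, x₀ • y = x • u) ∧
      ∀ p, π p = 0 → ∃ h ∈ I • (⊤ : Submodule R B), x₀ • p = u * h := by
  let K := FractionRing R
  have hRK := IsFractionRing.injective R K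
  have hinj : Function.Injective (MvPolynomial.map (σ := σ) (algebraMap R K)) :=
    MvPolynomial.map_injective _ hRK
  obtain ⟨u, hu, hπu, hdvd⟩ := exists_prime_generator K e ψ hψ π hπ
  have hu0 : e u ≠ 0 := by
    intro h
    rw [h, map_zero] at hu
    exact hu.ne_zero rfl
  obtain ⟨m₀, hm₀⟩ := MvPolynomial.ne_zero_iff.mp hu0
  set x₀ := (e u).coeff m₀ with hx₀
  let I : Ideal R :=
    { carrier := {x | ∃ y : B, x₀ • y = x • u}
      add_mem' := by
        rintro a b ⟨y, hy⟩ ⟨z, hz⟩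
        exact ⟨y + z, by rw [smul_add, hy, hz, add_smul]⟩
      zero_mem' := ⟨0, by simp⟩
      smul_mem' := by
        rintro c x ⟨y, hy⟩
        exact ⟨c • y, by rw [smul_comm, hy, smul_assoc]⟩ }
  refine ⟨I, x₀, u, ⟨u, rfl⟩, hm₀, fun h ↦ hu0 (by rw [h, map_zero]), hπu, fun x hx ↦ hx, ?_⟩
  intro p hp
  obtain ⟨q, hq⟩ := hdvd p hp
  have hx₀K : algebraMap R K x₀ ≠ 0 := fun h ↦ hm₀ (hRK (by rw [h, map_zero]))
  -- `f = u / x₀` has coefficient `1` at `m₀` and `f * h = p`, so Gauss's lemma gives `h = x₀ q`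
  -- coefficients in `R`.
  let f : MvPolynomial σ K :=
    MvPolynomial.C (algebraMap R K x₀)⁻¹ * (e u).map (algebraMap R K)
  let h : MvPolynomial σ K := MvPolynomial.C (algebraMap R K x₀) * q
  have hfh : f * h = (e p).map (algebraMap R K) := by
    rw [hq, mul_mul_mul_comm, ← MvPolynomial.C_mul, inv_mul_cancel₀ hx₀K, MvPolynomial.C_1,
      one_mul]
  have hprod : ∀ i j, f.coeff i * h.coeff j ∈ (algebraMap R K).range := by
    refine coeff_mul_coeff_mem_of_isIntegrallyClosed f h fun m ↦ ?_
    rw [hfh, MvPolynomial.coeff_map]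
    exact ⟨_, rfl⟩
  have hf : ∀ i, f.coeff i = (algebraMap R K x₀)⁻¹ * algebraMap R K ((e u).coeff i) := by
    intro i
    rw [MvPolynomial.coeff_C_mul, MvPolynomial.coeff_map]
  have hh : h ∈ Set.range (MvPolynomial.map (σ := σ) (algebraMap R K)) := by
    rw [MvPolynomial.mem_range_map_iff_coeffs_subset]
    intro c hc
    obtain ⟨m, -, rfl⟩ := MvPolynomial.mem_coeffs_iff.mp hc
    have := hprod m₀ m
    rw [hf, ← hx₀, inv_mul_cancel₀ hx₀K, one_mul] at this
    exact this
  obtain ⟨h', hh'⟩ := hh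
  have hrel : e (x₀ • p) = e u * h' := by
    apply hinj
    rw [map_smul, MvPolynomial.smul_eq_C_mul, map_mul, map_mul, hh', MvPolynomial.map_C, hq]
    ring
  refine ⟨e.symm h', ?_, ?_⟩
  -- By Gauss's lemma `x₀` divides each product of a coefficient of `u` with `h'.coeff m`, hence
  -- divides `h'.coeff m • u`; this is membership in `I`.
  · have hc : ∀ m, h'.coeff m ∈ I := by
      intro m
      have hx : ∀ i, ∃ r, (e u).coeff i * h'.coeff m = x₀ * r := by
        intro i
        obtain ⟨r, hr⟩ := hprod i m
        refine ⟨r, hRK ?_⟩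
        rw [map_mul, map_mul, hr, hf, ← hh', MvPolynomial.coeff_map]
        rw [← mul_assoc, ← mul_assoc, mul_inv_cancel₀ hx₀K, one_mul]
      have hdv : MvPolynomial.C x₀ ∣ h'.coeff m • e u := by
        rw [MvPolynomial.C_dvd_iff_dvd_coeff]
        intro i
        obtain ⟨r, hr⟩ := hx i
        exact ⟨r, by rw [← hr, MvPolynomial.coeff_smul, smul_eq_mul, mul_comm]⟩
      obtain ⟨y, hy⟩ := hdv
      refine ⟨e.symm y, e.injective ?_⟩
      rw [map_smul, map_smul, e.apply_symm_apply, hy, MvPolynomial.smul_eq_C_mul]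
    rw [h'.as_sum, map_sum]
    refine Submodule.sum_mem _ fun m _ ↦ ?_
    rw [← mul_one (h'.coeff m), ← smul_eq_mul, ← MvPolynomial.smul_monomial, map_smul]
    exact Submodule.smul_mem_smul (hc m) trivial
  · apply e.injective
    rw [map_mul, e.apply_symm_apply, hrel]

end HeightOne

/-! ### Symmetric algebras of invertible ideals. -/

section SymmetricAlgebra

/-- The symmetric algebra of a projective module over a domain has no zero divisors. -/
theorem noZeroDivisors_symmetricAlgebra_of_projective (A M : Type*) [CommRing A] [IsDomain A]
    [AddCommGroup M] [Module A M] [Module.Projective A M] :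
    NoZeroDivisors (SymmetricAlgebra A M) := by
  -- `M` is a direct summand of a free module, so by functoriality its symmetric algebra embeds into
  -- a polynomial ring.
  obtain ⟨s, hs⟩ := Module.Projective.out (R := A) (P := M)
  let t : (M →₀ A) →ₗ[A] M := Finsupp.linearCombination A id
  let S : SymmetricAlgebra A M →ₐ[A] SymmetricAlgebra A (M →₀ A) :=
    SymmetricAlgebra.lift (SymmetricAlgebra.ι A _ ∘ₗ s)
  let T : SymmetricAlgebra A (M →₀ A) →ₐ[A] SymmetricAlgebra A M :=
    SymmetricAlgebra.lift (SymmetricAlgebra.ι A _ ∘ₗ t)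
  have hTS : T.comp S = AlgHom.id A _ := by
    apply SymmetricAlgebra.algHom_ext
    ext m
    have : t (s m) = m := hs m
    simp [S, T, this]
  have hS : Function.Injective S :=
    Function.LeftInverse.injective (g := T) fun x ↦ DFunLike.congr_fun hTS x
  let e := SymmetricAlgebra.equivMvPolynomial (Finsupp.basisSingleOne (R := A) (ι := M))
  exact (e.injective.comp hS).noZeroDivisors (e ∘ S) (by simp) (by simp)

/-- An ideal of a domain that divides a nonzero principal ideal is invertible. -/
theorem isUnit_fractionalIdeal_of_mul_eq_span {R : Type*} [CommRing R] [IsDomain R]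
    {I J : Ideal R} {x : R} (hx : x ≠ 0) (h : J * I = Ideal.span {x}) :
    IsUnit (I : FractionalIdeal R⁰ (FractionRing R)) := by
  have h1 : (J : FractionalIdeal R⁰ (FractionRing R)) * I =
      FractionalIdeal.spanSingleton R⁰ (algebraMap R (FractionRing R) x) := by
    rw [← FractionalIdeal.coeIdeal_mul, h, FractionalIdeal.coeIdeal_span_singleton]
  have hx' : algebraMap R (FractionRing R) x ≠ 0 := by simpa using hx
  refine IsUnit.of_mul_eq_one (FractionalIdeal.spanSingleton R⁰
    (algebraMap R (FractionRing R) x)⁻¹ * J) ?_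
  rw [mul_comm, mul_assoc, h1, FractionalIdeal.spanSingleton_mul_spanSingleton,
    inv_mul_cancel₀ hx', FractionalIdeal.spanSingleton_one]

/-- An ideal of a domain that divides a nonzero principal ideal is projective. -/
theorem projective_of_mul_eq_span {R : Type*} [CommRing R] [IsDomain R]
    {I J : Ideal R} {x : R} (hx : x ≠ 0) (h : J * I = Ideal.span {x}) :
    Module.Projective R I := by
  obtain ⟨v, hv⟩ := isUnit_fractionalIdeal_of_mul_eq_span hx h
  have hu : IsUnit (IsLocalization.coeSubmodule (FractionRing R) I) := by
    have := (v.isUnit.map (FractionalIdeal.coeSubmoduleHom R⁰ (FractionRing R)))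
    rw [hv] at this
    exact this
  have : Module.Projective R (Submodule.map (Algebra.linearMap R (FractionRing R)) I) :=
    Submodule.projective_of_isUnit hu
  exact Module.Projective.of_equiv (Submodule.equivMapOfInjective
    (Algebra.linearMap R (FractionRing R)) (IsFractionRing.injective R (FractionRing R)) I).symm

/-- In the symmetric algebra of an ideal `J`, every element has a multiple by a power of a given
`x ∈ J` which is a polynomial in `x`. -/
theorem exists_pow_smul_eq_aeval {A : Type*} [CommRing A] {J : Ideal A} (x : J)
    (s : SymmetricAlgebra A J) :
    ∃ (N : ℕ) (F : A[X]), (x : A) ^ N • s = Polynomial.aeval (SymmetricAlgebra.ι A J x) F := by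
  induction s using SymmetricAlgebra.induction with
  | algebraMap r => exact ⟨0, Polynomial.C r, by simp⟩
  | ι y =>
    refine ⟨1, Polynomial.C (y : A) * Polynomial.X, ?_⟩
    -- Two elements of an ideal are proportional: after inverting `x`, the ideal is generated by `x`
    -- alone.
    have : (x : A) • y = (y : A) • x := Subtype.ext (mul_comm _ _)
    rw [pow_one, ← map_smul, this]
    simp [Algebra.smul_def]
  | mul a b ha hb =>
    obtain ⟨N, F, hF⟩ := ha
    obtain ⟨N', F', hF'⟩ := hb
    exact ⟨N + N', F * F', by rw [map_mul, ← hF, ← hF', pow_add, smul_mul_smul_comm]⟩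
  | add a b ha hb =>
    obtain ⟨N, F, hF⟩ := ha
    obtain ⟨N', F', hF'⟩ := hb
    refine ⟨N + N', Polynomial.C ((x : A) ^ N') * F + Polynomial.C ((x : A) ^ N) * F', ?_⟩
    rw [map_add, map_mul, map_mul, ← hF, ← hF', Polynomial.aeval_C, Polynomial.aeval_C,
      ← Algebra.smul_def, ← Algebra.smul_def, smul_smul, smul_smul, smul_add, pow_add,
      mul_comm (_ ^ N') (_ ^ N)]

/-- An algebra homomorphism from a symmetric algebra of an ideal `J` without zero divisors is injective if
it maps some nonzero element of `J` to a transcendental element. -/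
theorem injective_of_transcendental {A C : Type*} [CommRing A] [CommRing C]
    [Algebra A C] {J : Ideal A} [NoZeroDivisors (SymmetricAlgebra A J)] [IsDomain A]
    (Γ : SymmetricAlgebra A J →ₐ[A] C) (x : J) (hx : (x : A) ≠ 0)
    (htr : Transcendental A (Γ (SymmetricAlgebra.ι A J x))) : Function.Injective Γ := by
  rw [injective_iff_map_eq_zero]
  intro s hs
  obtain ⟨N, F, hF⟩ := exists_pow_smul_eq_aeval x s
  have h1 : Polynomial.aeval (Γ (SymmetricAlgebra.ι A J x)) F = 0 := by
    rw [Polynomial.aeval_algHom_apply, ← hF, map_smul, hs, smul_zero]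
  have h2 : F = 0 := by
    by_contra h0
    exact htr ⟨F, h0, h1⟩
  rw [h2, map_zero, Algebra.smul_def] at hF
  refine (mul_eq_zero.mp hF).resolve_left ?_
  rw [SymmetricAlgebra.algebraMap_eq_zero_iff]
  exact pow_ne_zero _ hx

end SymmetricAlgebra

/-! ### From the shape of the kernel to the symmetric algebra. -/

section Structure

/-- A nonzero element of the kernel of a retraction to `A` has positive degree under every
embedding into `A[X]`. -/
theorem natDegree_pos_of_map_eq_zero {A B : Type*} [CommRing A] [CommRing B]
    [Algebra A B] (ψ : B →ₐ[A] A[X]) (hψ : Function.Injective ψ)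
    (π : B →ₐ[A] A) {u : B} (hu : u ≠ 0) (hπu : π u = 0) : 0 < (ψ u).natDegree := by
  rw [Nat.pos_iff_ne_zero]
  intro h
  obtain ⟨a, ha⟩ := Polynomial.natDegree_eq_zero.mp h
  have hua : algebraMap A B a = u := hψ (by rw [← ha, AlgHom.commutes]; rfl)
  rw [← hua, AlgHom.commutes] at hπu
  change a = 0 at hπu
  exact hu (by rw [← hua, hπu, map_zero])

variable {R A B : Type*} [CommRing R] [CommRing A] [CommRing B] [IsDomain B]
  [Algebra R A] [Algebra A B] [Algebra R B] [IsScalarTower R A B]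

/-- If the kernel of a retraction `π` of a free `R`-algebra `B` with an augmentation is
`(u / x₀) I B` for an ideal `I` of `R`, then `I` divides `(x₀)`. -/
theorem exists_mul_eq_span_of_ker_eq [IsDomain R] [Module.Free R B] (ε : B →ₐ[R] R)
    (π : B →ₐ[A] A) {I : Ideal R} {x₀ : R} {u : B} (hu : u ≠ 0) (hπu : π u = 0)
    (hI : ∀ x ∈ I, ∃ y, x₀ • y = x • u)
    (hker : ∀ p, π p = 0 → ∃ h ∈ I • (⊤ : Submodule R B), x₀ • p = u * h) :
    ∃ J : Ideal R, J * I = Ideal.span {x₀} := by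
  let b := Module.Free.chooseBasis R B
  have hproj : ∀ m, ∃ h ∈ I • (⊤ : Submodule R B),
      x₀ • (b m - algebraMap A B (π (b m))) = u * h :=
    fun m ↦ hker _ (by simp)
  choose h hhI hh using hproj
  have hε : ∀ y ∈ I • (⊤ : Submodule R B), ε y ∈ I := by
    intro y hy
    refine Submodule.smul_induction_on hy (fun r hr z _ ↦ ?_) (fun y z hy hz ↦ ?_)
    · rw [map_smul, smul_eq_mul]
      exact I.mul_mem_right _ hr
    · rw [map_add]
      exact I.add_mem hy hz
  -- Expand `x₀ (u - π u) = x₀ u` in the basis, replace each `x₀ (b m - π (b m))` by `u * h m`, and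
  -- cancel `u`.
  have hsum : ∑ m ∈ (b.repr u).support, b.repr u m • h m = algebraMap R B x₀ := by
    apply mul_left_cancel₀ hu
    have hrep : ∑ m ∈ (b.repr u).support, b.repr u m • b m = u := by
      conv_rhs => rw [← b.linearCombination_repr u, Finsupp.linearCombination_apply]
      rfl
    have hrep' : ∑ m ∈ (b.repr u).support, b.repr u m • algebraMap A B (π (b m)) = 0 := by
      let τ : B →ₗ[R] B := (IsScalarTower.toAlgHom R A B).toLinearMap ∘ₗ
        (π.restrictScalars R).toLinearMap
      have := congrArg τ hrep
      rw [map_sum] at this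
      simp only [map_smul] at this
      refine this.trans ?_
      change algebraMap A B (π u) = 0
      rw [hπu, map_zero]
    calc u * ∑ m ∈ (b.repr u).support, b.repr u m • h m
        = ∑ m ∈ (b.repr u).support, x₀ • (b.repr u m • b m -
            b.repr u m • algebraMap A B (π (b m))) := by
          rw [Finset.mul_sum]
          refine Finset.sum_congr rfl fun m _ ↦ ?_
          rw [mul_smul_comm, ← hh, smul_comm, smul_sub]
      _ = x₀ • u := by
          rw [← Finset.smul_sum, Finset.sum_sub_distrib, hrep, hrep', sub_zero]
      _ = u * algebraMap R B x₀ := by rw [Algebra.smul_def, mul_comm]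
  -- `J` is the colon ideal `(x₀) : I`. Comparing coordinates in `x₀ y = x u` puts the coordinates
  -- of `u` in `J`; applying `ε` to `hsum` then writes `x₀` as an element of `J * I`.
  let J : Ideal R :=
    { carrier := {d | ∀ x ∈ I, x₀ ∣ d * x}
      add_mem' := fun ha hb x hx ↦ by
        rw [add_mul]
        exact dvd_add (ha x hx) (hb x hx)
      zero_mem' := fun x _ ↦ by simp
      smul_mem' := fun c d hd x hx ↦ by
        rw [smul_eq_mul, mul_assoc]
        exact (hd x hx).mul_left c }
  refine ⟨J, le_antisymm ?_ ?_⟩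
  · rw [Ideal.mul_le]
    intro d hd x hx
    exact Ideal.mem_span_singleton.mpr (hd x hx)
  · rw [Ideal.span_singleton_le_iff_mem]
    have := congrArg ε hsum
    rw [map_sum, AlgHom.commutes] at this
    change _ = x₀ at this
    rw [← this]
    refine Ideal.sum_mem _ fun m _ ↦ ?_
    rw [map_smul, smul_eq_mul]
    refine Ideal.mul_mem_mul (fun x hx ↦ ?_) (hε _ (hhI m))
    obtain ⟨y, hy⟩ := hI x hx
    refine ⟨b.repr y m, ?_⟩
    have := DFunLike.congr_fun (congrArg b.repr hy) m
    rw [map_smul, map_smul, Finsupp.smul_apply, Finsupp.smul_apply, smul_eq_mul,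
      smul_eq_mul] at this
    rw [this, mul_comm]

variable [IsDomain A] [FaithfulSMul R A]

/-- If the kernel of `π` is `(u / x₀) I B`, then `B` is generated over `A` by `(u / x₀) I`. -/
theorem mem_smul_of_mem_smul_top (ψ : B →ₐ[A] A[X]) (hψ : Function.Injective ψ)
    (π : B →ₐ[A] A) {I : Ideal R} {x₀ : R} {u : B} (hx₀ : x₀ ≠ 0) (hu : u ≠ 0) (hπu : π u = 0)
    (hker : ∀ p, π p = 0 → ∃ h ∈ I • (⊤ : Submodule R B), x₀ • p = u * h)
    (G : Subalgebra A B) (hG : ∀ x ∈ I, ∃ y ∈ G, x₀ • y = x • u) (d : ℕ) :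
    ∀ (𝔞 : Ideal R), ∀ b ∈ 𝔞 • (⊤ : Submodule R B), (ψ b).natDegree < d →
      b ∈ 𝔞 • (Subalgebra.toSubmodule G).restrictScalars R := by
  induction d with
  | zero => exact fun _ _ _ h ↦ absurd h (Nat.not_lt_zero _)
  | succ d ih =>
    intro 𝔞 b hb hd
    let Gs : Submodule R B := (Subalgebra.toSubmodule G).restrictScalars R
    let τ : B →ₗ[R] B := (IsScalarTower.toAlgHom R A B).toLinearMap ∘ₗ
      (π.restrictScalars R).toLinearMap
    let mx : B →ₗ[R] B := LinearMap.mulLeft R (algebraMap R B x₀)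
    let mu : B →ₗ[R] B := LinearMap.mulLeft R u
    have hmx : ∀ y, mx y = x₀ • y := fun y ↦ (Algebra.smul_def _ _).symm
    have hx₀A : algebraMap R A x₀ ≠ 0 := by simpa using hx₀
    have hAB : Function.Injective (algebraMap A B) :=
      Function.LeftInverse.injective (g := π) fun a ↦ π.commutes a
    have hx₀B : algebraMap R B x₀ ≠ 0 := by
      rw [IsScalarTower.algebraMap_apply R A B]
      exact fun h ↦ hx₀A (hAB (by rw [h, map_zero]))
    have hτb : τ b ∈ 𝔞 • Gs := by
      have h1 : τ b ∈ (𝔞 • (⊤ : Submodule R B)).map τ := Submodule.mem_map_of_mem hb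
      rw [Submodule.map_smul''] at h1
      refine SetLike.le_def.mp (smul_mono_right _ ?_) h1
      rintro _ ⟨y, -, rfl⟩
      exact G.algebraMap_mem (π y)
    set p := b - τ b with hp
    have hmxp : mx p ∈ (𝔞 • (I • (⊤ : Submodule R B))).map mu := by
      have h1 : mx p ∈ (𝔞 • (⊤ : Submodule R B)).map (mx ∘ₗ (LinearMap.id - τ)) :=
        ⟨b, hb, rfl⟩
      rw [Submodule.map_smul''] at h1 ⊢
      refine SetLike.le_def.mp (smul_mono_right _ ?_) h1
      rintro _ ⟨y, -, rfl⟩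
      obtain ⟨h, hh, hy⟩ := hker (y - τ y) (by simp [τ])
      exact ⟨h, hh, hy.symm.trans (hmx _).symm⟩
    suffices hpG : p ∈ 𝔞 • Gs by
      have : b = p + τ b := by rw [hp, sub_add_cancel]
      rw [this]
      exact Submodule.add_mem _ hpG hτb
    rcases eq_or_ne p 0 with h0 | h0
    · rw [h0]; exact Submodule.zero_mem _
    obtain ⟨h, hh, hmuh⟩ := hmxp
    have hrel : u * h = algebraMap R B x₀ * p := hmuh
    have hh0 : h ≠ 0 := by
      rintro rfl
      rw [mul_zero] at hrel
      exact mul_ne_zero hx₀B h0 hrel.symm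
    -- Degrees add in `u * h = x₀ p`; `ψ u` has positive degree, and subtracting the constant `π b`
    -- does not raise the degree of `ψ b`.
    have hdeg : (ψ h).natDegree < d := by
      have h1 := congrArg (fun z ↦ (ψ z).natDegree) hrel
      have h2 : ψ (algebraMap R B x₀) = Polynomial.C (algebraMap R A x₀) := by
        rw [IsScalarTower.algebraMap_apply R A B, AlgHom.commutes]; rfl
      rw [map_mul, map_mul, h2, Polynomial.natDegree_C_mul hx₀A, Polynomial.natDegree_mul
        ((map_ne_zero_iff ψ hψ).mpr hu) ((map_ne_zero_iff ψ hψ).mpr hh0)] at h1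
      have h3 := natDegree_pos_of_map_eq_zero ψ hψ π hu hπu
      have h4 : (ψ p).natDegree ≤ (ψ b).natDegree := by
        have : ψ p = ψ b - Polynomial.C (π b) := by
          rw [hp, map_sub]
          congr 1
          exact ψ.commutes (π b)
        rw [this, Polynomial.natDegree_sub_C]
      omega
    -- The induction hypothesis is applied to the ideal `𝔞 * I`, which is why `𝔞` varies: the factor
    -- `I` must be kept, since `u / x₀` maps `I • G`, but not necessarily `G`, into `G`.
    have hhG : h ∈ 𝔞 • (I • Gs) := by
      rw [← Submodule.mul_smul]
      rw [← Submodule.mul_smul] at hh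
      exact ih _ h hh hdeg
    have hfin : mx p ∈ (𝔞 • Gs).map mx := by
      rw [← hmuh, Submodule.map_smul'']
      have h1 : mu h ∈ (𝔞 • (I • Gs)).map mu := Submodule.mem_map_of_mem hhG
      rw [Submodule.map_smul''] at h1
      refine SetLike.le_def.mp (smul_mono_right _ ?_) h1
      rw [Submodule.map_smul'', Submodule.smul_le]
      rintro x hx _ ⟨γ, hγ, rfl⟩
      obtain ⟨y, hy, hyx⟩ := hG x hx
      refine ⟨y * γ, G.mul_mem hy hγ, ?_⟩
      rw [hmx, ← smul_mul_assoc, hyx, smul_mul_assoc]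
      rfl
    obtain ⟨p', hp', hpp'⟩ := hfin
    have : p' = p := mul_left_cancel₀ hx₀B hpp'
    rwa [← this]

/-- If the kernel of a retraction of `B` to `A` is `(u / x₀) I B` with `I` an invertible ideal of
`R`, and if `B` embeds into `A[X]`, then `B` is the symmetric algebra of `IA`. -/
theorem nonempty_algEquiv_symmetricAlgebra (ψ : B →ₐ[A] A[X]) (hψ : Function.Injective ψ)
    (π : B →ₐ[A] A) {I J : Ideal R} {x₀ : R} {u : B} (hx₀I : x₀ ∈ I) (hx₀ : x₀ ≠ 0)
    (hu : u ≠ 0) (hπu : π u = 0) (hI : ∀ x ∈ I, ∃ y, x₀ • y = x • u)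
    (hker : ∀ p, π p = 0 → ∃ h ∈ I • (⊤ : Submodule R B), x₀ • p = u * h)
    (hJ : J * I = Ideal.span {x₀}) :
    Nonempty (B ≃ₐ[A] SymmetricAlgebra A (I.map (algebraMap R A))) := by
  let IA : Ideal A := I.map (algebraMap R A)
  have hx₀A : algebraMap R A x₀ ≠ 0 := by simpa using hx₀
  have hAB : Function.Injective (algebraMap A B) :=
    Function.LeftInverse.injective (g := π) fun a ↦ π.commutes a
  have hcancel : ∀ y z : B, algebraMap R A x₀ • y = algebraMap R A x₀ • z → y = z := by
    intro y z h
    rw [Algebra.smul_def, Algebra.smul_def] at h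
    exact mul_left_cancel₀ (fun h0 ↦ hx₀A (hAB (by rw [h0, map_zero]))) h
  -- The `a ∈ A` for which `(u / x₀) a` makes sense in `B`; `jl` below is multiplication by `u / x₀`
  -- on `IA`.
  let L : Ideal A :=
    { carrier := {a | ∃ y : B, algebraMap R A x₀ • y = a • u}
      add_mem' := by
        rintro a b ⟨y, hy⟩ ⟨z, hz⟩
        exact ⟨y + z, by rw [smul_add, hy, hz, add_smul]⟩
      zero_mem' := ⟨0, by simp⟩
      smul_mem' := by
        rintro c x ⟨y, hy⟩
        exact ⟨c • y, by rw [smul_comm, hy, smul_assoc]⟩ }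
  have hL : IA ≤ L := by
    rw [Ideal.map_le_iff_le_comap]
    intro x hx
    obtain ⟨y, hy⟩ := hI x hx
    exact ⟨y, by rw [algebraMap_smul, algebraMap_smul, hy]⟩
  choose j hj using fun a : IA ↦ hL a.2
  let jl : IA →ₗ[A] B :=
    { toFun := j
      map_add' := fun a b ↦ hcancel _ _ (by
        rw [hj, smul_add, hj, hj, ← add_smul]; rfl)
      map_smul' := fun c a ↦ hcancel _ _ (by
        rw [hj, RingHom.id_apply, smul_comm, hj, ← smul_assoc]; rfl) }
  let Γ : SymmetricAlgebra A IA →ₐ[A] B := SymmetricAlgebra.lift jl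
  have hproj : Module.Projective A IA := by
    refine projective_of_mul_eq_span (J := J.map (algebraMap R A)) hx₀A ?_
    rw [← Ideal.map_mul, hJ, Ideal.map_span, Set.image_singleton]
  have := noZeroDivisors_symmetricAlgebra_of_projective A IA
  have hinj : Function.Injective Γ := by
    refine injective_of_transcendental Γ ⟨_, Ideal.mem_map_of_mem _ hx₀I⟩ hx₀A ?_
    have hΓ : Γ (SymmetricAlgebra.ι A IA ⟨_, Ideal.mem_map_of_mem _ hx₀I⟩) = u := by
      rw [SymmetricAlgebra.lift_ι_apply]
      exact hcancel _ _ (hj _)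
    rw [hΓ]
    have hdeg := natDegree_pos_of_map_eq_zero ψ hψ π hu hπu
    intro halg
    refine Polynomial.transcendental (ψ u) hdeg.ne' ?_ (halg.algHom ψ)
    exact mem_nonZeroDivisors_of_ne_zero
      (Polynomial.leadingCoeff_ne_zero.mpr ((map_ne_zero_iff ψ hψ).mpr hu))
  have hsurj : Function.Surjective Γ := by
    intro b
    have h1 := mem_smul_of_mem_smul_top ψ hψ π hx₀ hu hπu hker Γ.range (fun x hx ↦ by
      refine ⟨Γ (SymmetricAlgebra.ι A IA ⟨_, Ideal.mem_map_of_mem _ hx⟩), ⟨_, rfl⟩, ?_⟩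
      rw [SymmetricAlgebra.lift_ι_apply, ← algebraMap_smul A x₀, ← algebraMap_smul A x]
      exact hj _) _ ⊤ b (by rw [Submodule.top_smul]; trivial) (Nat.lt_succ_self _)
    rw [Submodule.top_smul] at h1
    exact h1
  exact ⟨(AlgEquiv.ofBijective Γ ⟨hinj, hsurj⟩).symm⟩

end Structure

/-! ### Embedding `B` into `A[X]` from an action or a derivation. -/

section Embedding

/-- A retract is the image of an algebra retraction over itself. -/
theorem IsRetract.exists_algHom {R B : Type*} [CommRing R] [CommRing B] [Algebra R B]
    {A : Subalgebra R B} (h : IsRetract A.toSubring) : Nonempty (B →ₐ[A] A) := by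
  obtain ⟨π, hπ, hr⟩ := h
  have hmem : ∀ b, π b ∈ A := fun b ↦ by
    have : π b ∈ A.toSubring := hr ▸ ⟨b, rfl⟩
    exact this
  have hid : ∀ a : A, π a = a := fun a ↦ by
    have : (a : B) ∈ π.range := hr ▸ a.2
    obtain ⟨c, hc⟩ := this
    rw [← hc]
    exact DFunLike.congr_fun hπ c
  exact ⟨{ toRingHom := π.codRestrict A hmem, commutes' := fun a ↦ Subtype.ext (hid a) }⟩

/-- The leading coefficient of `φ b` is an invariant of the exponential map `φ`. -/
theorem IsExponentialMap.leadingCoeff_mem_invariants {k B : Type*} [CommRing k] [CommRing B]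
    [Algebra k B] {φ : B →ₐ[k] B[X]} (hφ : IsExponentialMap φ) (b : B) :
    (φ b).leadingCoeff ∈ invariants φ := by
  -- Compare coefficients of the top power of `U` in `φ_V φ_U b = φ_{V+U} b`: on the right only the
  -- leading term contributes, and without `V`.
  have h := congrArg (fun F ↦ F.coeff (φ b).natDegree) (hφ.map_map b)
  simp only [Polynomial.coeff_map, Polynomial.eval₂_eq_sum_range, Polynomial.finsetSum_coeff,
    add_comm (Polynomial.C Polynomial.X) Polynomial.X, RingHom.comp_apply,
    Polynomial.coeff_C_mul, Polynomial.coeff_X_add_C_pow] at h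
  rw [Finset.sum_range_succ, Finset.sum_eq_zero, zero_add, Nat.sub_self, pow_zero,
    Nat.choose_self, Nat.cast_one, mul_one, mul_one] at h
  · exact h
  · intro i hi
    rw [Nat.choose_eq_zero_of_lt (Finset.mem_range.mp hi), Nat.cast_zero, mul_zero, mul_zero]

/-- If `A` is the ring of invariants of an exponential map on `B` over `A` and `B` retracts
to `A`, then `B` embeds into `A[X]`. -/
theorem IsExponentialMap.exists_injective {R B : Type*} [CommRing R] [CommRing B] [Algebra R B]
    {A : Subalgebra R B} {φ : B →ₐ[A] B[X]} (hφ : IsExponentialMap φ)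
    (hA : A.toSubring = invariants φ) (π : B →ₐ[A] A) :
    ∃ ψ : B →ₐ[A] A[X], Function.Injective ψ := by
  refine ⟨(Polynomial.mapAlgHom π).comp φ, ?_⟩
  rw [injective_iff_map_eq_zero]
  intro b hb
  by_contra h0
  have hφb : φ b ≠ 0 := by
    intro h
    have := hφ.eval_zero b
    rw [h, Polynomial.eval_zero] at this
    exact h0 this.symm
  have hmem : (φ b).leadingCoeff ∈ A.toSubring := hA ▸ hφ.leadingCoeff_mem_invariants b
  have h1 := congrArg (fun F ↦ F.coeff (φ b).natDegree) hb
  simp only [AlgHom.comp_apply, Polynomial.coe_mapAlgHom, Polynomial.coeff_map,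
    Polynomial.coeff_zero] at h1
  have h2 : π (φ b).leadingCoeff = ⟨_, hmem⟩ := π.commutes ⟨_, hmem⟩
  have h3 : (⟨_, hmem⟩ : A) = 0 := h2.symm.trans h1
  exact hφb (Polynomial.leadingCoeff_eq_zero.mp (congrArg Subtype.val h3))

/-- The iterated Leibniz rule. -/
theorem iterate_derivation_mul {k B : Type*} [CommRing k] [CommRing B] [Algebra k B]
    (D : Derivation k B B) (n : ℕ) (a b : B) :
    (⇑D)^[n] (a * b) = ∑ ij ∈ Finset.HasAntidiagonal.antidiagonal n,
      (n.choose ij.1 : B) * ((⇑D)^[ij.1] a * (⇑D)^[ij.2] b) := by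
  induction n with
  | zero => simp
  | succ n ih =>
    rw [Finset.sum_antidiagonal_choose_succ_mul (fun i j ↦ (⇑D)^[i] a * (⇑D)^[j] b) n]
    rw [Function.iterate_succ_apply', ih, map_sum, ← Finset.sum_add_distrib]
    refine Finset.sum_congr rfl fun ij hij ↦ ?_
    rw [Derivation.leibniz, Derivation.map_natCast, smul_zero, add_zero, Derivation.leibniz,
      smul_eq_mul, smul_eq_mul, smul_eq_mul, ← Function.iterate_succ_apply' (⇑D) ij.2 b,
      ← Function.iterate_succ_apply' (⇑D) ij.1 a,
      Nat.choose_symm_of_eq_add (Finset.HasAntidiagonal.mem_antidiagonal.mp hij).symm]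
    ring

/-- If `A` is the kernel of a locally nilpotent derivation on a `ℚ`-algebra `B` and `B` retracts
to `A`, then `B` embeds into `A[X]`. -/
theorem IsLocallyNilpotent.exists_injective {R B : Type*} [CommRing R] [CommRing B] [Algebra R B]
    {A : Subalgebra R B} {D : Derivation R B B} (hD : IsLocallyNilpotent D)
    (hA : Subalgebra.toSubmodule A = LinearMap.ker (D : B →ₗ[R] B)) (π : B →ₐ[A] A)
    (q : ℚ →+* R) : ∃ ψ : B →ₐ[A] A[X], Function.Injective ψ := by
  have hker : ∀ b, b ∈ A ↔ D b = 0 := fun b ↦ by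
    rw [← Subalgebra.mem_toSubmodule, hA]
    rfl
  let g : ℚ →+* A := (algebraMap R A).comp q
  -- The inverse of `i!` in `A`; `hcc` is the identity that makes the exponential series
  -- multiplicative.
  let c : ℕ → A := fun i ↦ g (i.factorial : ℚ)⁻¹
  have hc : ∀ i, c i * (i.factorial : A) = 1 := fun i ↦ by
    have : (i.factorial : A) = g (i.factorial : ℚ) := (map_natCast g _).symm
    rw [this, ← map_mul, inv_mul_cancel₀ (by exact_mod_cast i.factorial_ne_zero), map_one]
  have hcc : ∀ i j, c (i + j) * ((i + j).choose i : A) = c i * c j := fun i j ↦ by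
    have : ((i + j).choose i : A) = g ((i + j).choose i : ℚ) := (map_natCast g _).symm
    rw [this, ← map_mul, ← map_mul]
    congr 1
    have h' : ((i + j).choose i : ℚ) * i.factorial * j.factorial = (i + j).factorial := by
      rw [Nat.choose_symm_add]
      exact_mod_cast Nat.add_choose_mul_factorial_mul_factorial i j
    have h1 : (i.factorial : ℚ) ≠ 0 := by exact_mod_cast i.factorial_ne_zero
    have h2 : (j.factorial : ℚ) ≠ 0 := by exact_mod_cast j.factorial_ne_zero
    have h3 : ((i + j).factorial : ℚ) ≠ 0 := by exact_mod_cast (i + j).factorial_ne_zero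
    field_simp
    linear_combination h'
  have hiter0 : ∀ n, (⇑D)^[n] 0 = 0 := fun n ↦ Function.iterate_fixed (map_zero D) n
  have hpoly : ∀ b, ∃ F : A[X], ∀ i, F.coeff i = c i * π ((⇑D)^[i] b) := by
    intro b
    obtain ⟨m, -, hm⟩ := hD b
    refine ⟨∑ i ∈ Finset.range m, Polynomial.monomial i (c i * π ((⇑D)^[i] b)), fun i ↦ ?_⟩
    rw [Polynomial.finsetSum_coeff]
    simp only [Polynomial.coeff_monomial, Finset.sum_ite_eq', Finset.mem_range]
    split_ifs with h
    · rfl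
    · obtain ⟨l, rfl⟩ := Nat.exists_eq_add_of_le' (not_lt.mp h)
      rw [Function.iterate_add_apply, hm, hiter0, map_zero, mul_zero]
  choose E hE using hpoly
  have hiterA : ∀ (a : A) n, c n * π ((⇑D)^[n] (algebraMap A B a)) = if n = 0 then a else 0 := by
    intro a n
    rcases n with _ | n
    · have : c 0 = 1 := by simpa using hc 0
      rw [this, one_mul, if_pos rfl]
      exact π.commutes a
    · have : D (algebraMap A B a) = 0 := (hker _).mp a.2
      rw [Function.iterate_succ_apply, this, hiter0, map_zero, mul_zero]
      simp
  have hEA : ∀ a : A, E (algebraMap A B a) = Polynomial.C a := fun a ↦ by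
    refine Polynomial.ext fun i ↦ ?_
    rw [hE, hiterA, Polynomial.coeff_C]
  let ψ : B →ₐ[A] A[X] :=
    { toFun := E
      map_one' := by
        rw [← map_one (algebraMap A B), hEA, map_one]
      map_zero' := by
        rw [← map_zero (algebraMap A B), hEA, map_zero]
      map_add' := fun a b ↦ by
        refine Polynomial.ext fun i ↦ ?_
        rw [hE, Polynomial.coeff_add, hE, hE, ← mul_add, ← map_add, iterate_map_add]
      map_mul' := fun a b ↦ by
        refine Polynomial.ext fun n ↦ ?_
        rw [hE, Polynomial.coeff_mul, iterate_derivation_mul, map_sum, Finset.mul_sum]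
        refine Finset.sum_congr rfl fun ij hij ↦ ?_
        obtain rfl := Finset.HasAntidiagonal.mem_antidiagonal.mp hij
        rw [hE, hE, map_mul, map_mul, map_natCast, ← mul_assoc, hcc]
        ring
      commutes' := hEA }
  refine ⟨ψ, ?_⟩
  rw [injective_iff_map_eq_zero]
  intro b hb
  by_contra h0
  classical
  have hex : ∃ m, (⇑D)^[m] b = 0 := (hD b).imp fun _ h ↦ h.2
  obtain ⟨m, hm⟩ : ∃ m, Nat.find hex = m + 1 := by
    refine Nat.exists_eq_succ_of_ne_zero fun h ↦ h0 ?_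
    have := Nat.find_spec hex
    rwa [h] at this
  -- The last nonzero iterate lies in `ker D = A`, so `π` fixes it and the coefficient of `X ^ m` in
  -- `ψ b` cannot vanish.
  have h1 : (⇑D)^[m] b ≠ 0 := Nat.find_min hex (by omega)
  have h2 : (⇑D)^[m] b ∈ A := by
    rw [hker, ← Function.iterate_succ_apply' (⇑D), Nat.succ_eq_add_one, ← hm]
    exact Nat.find_spec hex
  have h3 : c m * π ((⇑D)^[m] b) = 0 := by
    rw [← hE]
    exact congrArg (fun F ↦ F.coeff m) hb
  have h4 : π ((⇑D)^[m] b) = ⟨_, h2⟩ := π.commutes ⟨_, h2⟩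
  have h5 : (⟨_, h2⟩ : A) = 0 := by
    rw [← one_mul (⟨_, h2⟩ : A), ← hc m, mul_right_comm, ← h4, h3, zero_mul]
  exact h1 (congrArg Subtype.val h5)

theorem faithfulSMul_of_algEquiv_mvPolynomial {σ R B : Type*} [CommRing R] [CommRing B]
    [Algebra R B] (e : B ≃ₐ[R] MvPolynomial σ R) : FaithfulSMul R B := by
  rw [faithfulSMul_iff_algebraMap_injective]
  intro x y hxy
  have := congrArg e hxy
  rw [e.commutes, e.commutes] at this
  exact MvPolynomial.C_injective σ R this

/-- If a polynomial ring `B` over an integrally closed domain retracts to a proper subalgebra `A`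
and embeds into `A[X]`, then it is the symmetric algebra of the extension to `A` of an invertible
ideal. -/
theorem isSymOfInvertibleIdeal_of_injective {σ R B : Type*} [CommRing R] [IsDomain R]
    [IsIntegrallyClosed R] [CommRing B] [Algebra R B] (e : B ≃ₐ[R] MvPolynomial σ R)
    {A : Subalgebra R B} (π : B →ₐ[A] A) (ψ : B →ₐ[A] A[X]) (hψ : Function.Injective ψ)
    (hA : ∃ b, b ∉ A) : IsSymOfInvertibleIdeal A := by
  have : IsDomain B := e.toMulEquiv.isDomain
  have : Module.Free R B := Module.Free.of_equiv e.symm.toLinearEquiv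
  have : FaithfulSMul R B := faithfulSMul_of_algEquiv_mvPolynomial e
  have : FaithfulSMul R A := by
    rw [faithfulSMul_iff_algebraMap_injective]
    intro x y hxy
    exact FaithfulSMul.algebraMap_injective R B (congrArg (algebraMap A B) hxy)
  have hπ : ∃ p, p ≠ 0 ∧ π p = 0 := by
    obtain ⟨b, hb⟩ := hA
    refine ⟨b - algebraMap A B (π b), fun h ↦ hb ?_, by
      rw [map_sub, sub_eq_zero]
      exact (π.commutes (π b)).symm⟩
    rw [sub_eq_zero.mp h]
    exact (π b).2
  obtain ⟨I, x₀, u, hx₀I, hx₀, hu, hπu, hI, hker⟩ := exists_ideal_generating_ker e ψ hψ π hπ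
  -- Evaluation of the polynomial variables at the origin.
  let ε : B →ₐ[R] R := (MvPolynomial.aeval (fun _ : σ ↦ (0 : R))).comp (e : B →ₐ[R] _)
  obtain ⟨J, hJ⟩ := exists_mul_eq_span_of_ker_eq ε π hu hπu hI hker
  exact ⟨I, isUnit_fractionalIdeal_of_mul_eq_span hx₀ hJ,
    nonempty_algEquiv_symmetricAlgebra ψ hψ π hx₀I hx₀ hu hπu hI hker hJ⟩

end Embedding

/-! ### The action and the derivation on a symmetric algebra. -/

section Converse

variable {A B : Type*} [CommRing A] [CommRing B] [Algebra A B] {J : Ideal A} {j : J →ₗ[A] B}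

/-- The homomorphism from a symmetric algebra of an ideal `J` of `A` to `A[X]` that maps a
generator `x ∈ J` to `x X`. -/
noncomputable def toPolynomial (hj : IsSymmetricAlgebra j) : B →ₐ[A] A[X] :=
  hj.lift (LinearMap.toSpanSingleton A A[X] Polynomial.X ∘ₗ J.subtype)

theorem toPolynomial_apply (hj : IsSymmetricAlgebra j) (x : J) :
    toPolynomial hj (j x) = (x : A) • Polynomial.X := by
  simp [toPolynomial]

theorem toPolynomial_injective [IsDomain A] [IsDomain B] (hj : IsSymmetricAlgebra j)
    (hJ : J ≠ ⊥) : Function.Injective (toPolynomial hj) := by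
  obtain ⟨x, hx, hx0⟩ := Submodule.exists_mem_ne_zero_of_ne_bot hJ
  have : NoZeroDivisors (SymmetricAlgebra A J) :=
    hj.equiv.injective.noZeroDivisors _ (map_zero _) (map_mul _)
  have hinj := injective_of_transcendental ((toPolynomial hj).comp hj.equiv.toAlgHom) ⟨x, hx⟩ hx0
    (by
      have h1 : ((toPolynomial hj).comp hj.equiv.toAlgHom)
          (SymmetricAlgebra.ι A J ⟨x, hx⟩) = Polynomial.C x * Polynomial.X := by
        simp [toPolynomial_apply, Polynomial.smul_eq_C_mul]
      rw [h1]
      refine Polynomial.transcendental _ ?_ ?_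
      · rw [Polynomial.natDegree_C_mul_X x hx0]
        exact one_ne_zero
      · rw [Polynomial.leadingCoeff_C_mul_X]
        exact mem_nonZeroDivisors_of_ne_zero hx0)
  intro a b hab
  obtain ⟨a, rfl⟩ := hj.equiv.surjective a
  obtain ⟨b, rfl⟩ := hj.equiv.surjective b
  rw [hinj hab]

/-- The translation `x ↦ x + x U` on a symmetric algebra of an ideal. -/
noncomputable def translation (hj : IsSymmetricAlgebra j) : B →ₐ[A] B[X] :=
  hj.lift ((trivialMap A B).toLinearMap ∘ₗ j +
    LinearMap.toSpanSingleton A B[X] Polynomial.X ∘ₗ J.subtype)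

theorem translation_apply (hj : IsSymmetricAlgebra j) (x : J) :
    translation hj (j x) = Polynomial.C (j x) + (x : A) • Polynomial.X := by
  simp [translation, trivialMap]

/-- Algebra maps out of a symmetric algebra agree once they agree on `J`, where both sides of the
group law are `x + x (V + U)`. -/
theorem isExponentialMap_translation (hj : IsSymmetricAlgebra j) :
    IsExponentialMap (translation hj) where
  eval_zero b := by
    have h : ((Polynomial.aeval (0 : B) : B[X] →ₐ[B] B).restrictScalars A).comp
        (translation hj) = AlgHom.id A B := by
      refine hj.algHom_ext (LinearMap.ext fun x ↦ ?_)
      simp [translation_apply]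
    simpa [Polynomial.coe_aeval_eq_eval] using DFunLike.congr_fun h b
  map_map b := by
    let s : B[X] →ₐ[A] B[X][X] := (Polynomial.aeval
      (Polynomial.C Polynomial.X + Polynomial.X : B[X][X]) : B[X] →ₐ[B] B[X][X]).restrictScalars A
    have h : (Polynomial.mapAlgHom (translation hj)).comp (translation hj) =
        s.comp (translation hj) := by
      refine hj.algHom_ext (LinearMap.ext fun x ↦ ?_)
      have hs : s (Polynomial.C (j x) + (x : A) • Polynomial.X) =
          Polynomial.C (Polynomial.C (j x)) +
            (x : A) • (Polynomial.C Polynomial.X + Polynomial.X) := by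
        rw [map_add, map_smul]
        simp only [s, AlgHom.restrictScalars_apply, Polynomial.aeval_X, Polynomial.aeval_C]
        rfl
      have hm : Polynomial.mapAlgHom (translation hj) (Polynomial.C (j x) +
          (x : A) • Polynomial.X) =
          Polynomial.C (Polynomial.C (j x) + (x : A) • Polynomial.X) +
            (x : A) • Polynomial.X := by
        rw [map_add, map_smul]
        simp [translation_apply]
      change Polynomial.mapAlgHom (translation hj) (translation hj (j x)) =
        s (translation hj (j x))
      rw [translation_apply, hs, hm, map_add, smul_add, add_assoc, Polynomial.smul_C]
    exact DFunLike.congr_fun h b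

/-- The augmentation of a symmetric algebra. -/
noncomputable def augmentation (hj : IsSymmetricAlgebra j) : B →ₐ[A] A :=
  hj.lift 0

/-- The embedding into `A[X]` is again the action followed by the retraction, so an invariant
element has constant image and must lie in `A`. -/
theorem map_augmentation_translation (hj : IsSymmetricAlgebra j) (b : B) :
    (translation hj b).map (augmentation hj : B →+* A) = toPolynomial hj b := by
  have h : (Polynomial.mapAlgHom (augmentation hj)).comp (translation hj) = toPolynomial hj := by
    refine hj.algHom_ext (LinearMap.ext fun x ↦ ?_)
    have : augmentation hj (j x) = 0 := by simp [augmentation]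
    change Polynomial.mapAlgHom (augmentation hj) (translation hj (j x)) = toPolynomial hj (j x)
    rw [translation_apply, toPolynomial_apply, map_add, map_smul]
    simp [this]
  exact DFunLike.congr_fun h b

theorem algebraMap_of_toPolynomial_eq_C [IsDomain A] [IsDomain B] (hj : IsSymmetricAlgebra j)
    (hJ : J ≠ ⊥) {b : B} {a : A} (h : toPolynomial hj b = Polynomial.C a) :
    algebraMap A B a = b :=
  toPolynomial_injective hj hJ (by rw [h, AlgHom.commutes]; rfl)

theorem mem_invariants_translation_iff [IsDomain A] [IsDomain B] (hj : IsSymmetricAlgebra j)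
    (hJ : J ≠ ⊥) (b : B) : b ∈ invariants (translation hj) ↔ b ∈ (algebraMap A B).range := by
  constructor
  · intro h
    have h1 : translation hj b = Polynomial.C b := h
    have h2 := map_augmentation_translation hj b
    rw [h1, Polynomial.map_C] at h2
    exact ⟨_, algebraMap_of_toPolynomial_eq_C hj hJ h2.symm⟩
  · rintro ⟨a, rfl⟩
    exact (translation hj).commutes a

/-- The derivation of a symmetric algebra of an ideal that maps every generator `x` to the
scalar `x`. -/
noncomputable def symDerivation (hj : IsSymmetricAlgebra j) : Derivation A B B :=
  Derivation.mk' (((Polynomial.lcoeff B 1).restrictScalars A) ∘ₗ (translation hj).toLinearMap)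
    fun a b ↦ by
      have h0 : ∀ c, (translation hj c).coeff 0 = c := fun c ↦ by
        rw [Polynomial.coeff_zero_eq_eval_zero]
        exact (isExponentialMap_translation hj).eval_zero c
      change (translation hj (a * b)).coeff 1 = a * (translation hj b).coeff 1 +
        b * (translation hj a).coeff 1
      rw [map_mul, Polynomial.mul_coeff_one, h0, h0]
      ring

theorem symDerivation_apply (hj : IsSymmetricAlgebra j) (x : J) :
    symDerivation hj (j x) = algebraMap A B x := by
  change (translation hj (j x)).coeff 1 = _
  simp [translation_apply, Polynomial.coeff_C, Algebra.smul_def]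

/-- Transports local nilpotency and, in characteristic zero, the computation of the kernel from
`d/dX` on `A[X]`. -/
theorem toPolynomial_symDerivation (hj : IsSymmetricAlgebra j) (b : B) :
    toPolynomial hj (symDerivation hj b) = Polynomial.derivative (toPolynomial hj b) := by
  induction b using hj.induction with
  | algebraMap r => simp
  | ι x =>
    rw [symDerivation_apply, AlgHom.commutes, toPolynomial_apply, Polynomial.derivative_smul]
    simp [Polynomial.smul_eq_C_mul]
  | mul a b ha hb =>
    rw [Derivation.leibniz, map_add, smul_eq_mul, smul_eq_mul, map_mul, map_mul, map_mul, ha, hb,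
      Polynomial.derivative_mul]
    ring
  | add a b ha hb => rw [map_add, map_add, map_add, map_add, ha, hb]

theorem exists_iterate_symDerivation_eq_zero [IsDomain A] [IsDomain B]
    (hj : IsSymmetricAlgebra j) (hJ : J ≠ ⊥) (b : B) :
    ∃ m : ℕ, 0 < m ∧ (⇑(symDerivation hj))^[m] b = 0 := by
  refine ⟨_, Nat.succ_pos (toPolynomial hj b).natDegree, toPolynomial_injective hj hJ ?_⟩
  have h : ∀ m, toPolynomial hj ((⇑(symDerivation hj))^[m] b) =
      Polynomial.derivative^[m] (toPolynomial hj b) := fun m ↦ by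
    induction m with
    | zero => rfl
    | succ m ih =>
      rw [Function.iterate_succ_apply', Function.iterate_succ_apply',
        toPolynomial_symDerivation, ih]
  rw [h, map_zero, Polynomial.iterate_derivative_eq_zero (Nat.lt_succ_self _)]

theorem symDerivation_eq_zero_iff [IsDomain A] [IsDomain B] [CharZero A]
    (hj : IsSymmetricAlgebra j) (hJ : J ≠ ⊥) (b : B) :
    symDerivation hj b = 0 ↔ b ∈ (algebraMap A B).range := by
  constructor
  · intro h
    have h1 := toPolynomial_symDerivation hj b
    rw [h, map_zero] at h1
    have h2 := Polynomial.eq_C_of_derivative_eq_zero h1.symm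
    exact ⟨_, algebraMap_of_toPolynomial_eq_C hj hJ h2⟩
  · rintro ⟨a, rfl⟩
    exact (symDerivation hj).map_algebraMap a

end Converse

/-! ### Passing between subalgebras, retracts and symmetric algebras. -/

section Subalgebra

variable {R B : Type*} [CommRing R] [CommRing B] [Algebra R B] {A : Subalgebra R B}

theorem isRetract_of_algHom (π : B →ₐ[A] A) : IsRetract A.toSubring := by
  refine ⟨(algebraMap A B).comp (π : B →+* A), ?_, ?_⟩
  · ext b
    exact congrArg (algebraMap A B) (π.commutes (π b))
  · ext b
    constructor
    · rintro ⟨c, rfl⟩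
      exact (π c).2
    · intro hb
      exact ⟨b, congrArg (algebraMap A B) (π.commutes ⟨b, hb⟩)⟩

theorem mem_range_algebraMap_subalgebra_iff (b : B) :
    b ∈ (algebraMap A B).range ↔ b ∈ A :=
  ⟨by rintro ⟨a, rfl⟩; exact a.2, fun h ↦ ⟨⟨b, h⟩, rfl⟩⟩

/-- The data of `IsSymOfInvertibleIdeal` in terms of the universal property. -/
theorem IsSymOfInvertibleIdeal.exists_isSymmetricAlgebra [IsDomain R] [FaithfulSMul R B]
    (h : IsSymOfInvertibleIdeal A) :
    ∃ (J : Ideal A) (j : J →ₗ[A] B), J ≠ ⊥ ∧ IsSymmetricAlgebra j := by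
  obtain ⟨I, hI, ⟨e⟩⟩ := h
  refine ⟨I.map (algebraMap R A), _, ?_, IsSymmetricAlgebra.comp_equiv e.symm⟩
  have hI0 : I ≠ ⊥ := by
    rintro rfl
    exact hI.ne_zero (FractionalIdeal.coeIdeal_bot)
  have hinj : Function.Injective (algebraMap R A) := fun x y hxy ↦
    FaithfulSMul.algebraMap_injective R B (congrArg (algebraMap A B) hxy)
  rwa [Ne, Ideal.map_eq_bot_iff_of_injective hinj]

end Subalgebra

end GaAction

/-! ### The equivalences. -/

theorem theorem4p3 {R B : Type*} [CommRing R] [IsDomain R] [IsNoetherianRing R]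
    [IsIntegrallyClosed R] [CommRing B] [Algebra R B] (n : ℕ)
    (hB : Nonempty (B ≃ₐ[R] MvPolynomial (Fin n) R)) (A : Subalgebra R B) :
    ((GaAction.IsRetract A.toSubring ∧
        ∃ φ : B →ₐ[A] Polynomial B, GaAction.IsExponentialMap φ ∧
          φ ≠ GaAction.trivialMap A B ∧ A.toSubring = GaAction.invariants φ) ↔
      GaAction.IsSymOfInvertibleIdeal A) ∧
    (Nonempty (ℚ →+* R) →
      ((GaAction.IsRetract A.toSubring ∧
          ∃ D : Derivation R B B, GaAction.IsLocallyNilpotent D ∧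
            D ≠ 0 ∧ Subalgebra.toSubmodule A = LinearMap.ker (D : B →ₗ[R] B)) ↔
        GaAction.IsSymOfInvertibleIdeal A)) := by
  obtain ⟨e⟩ := hB
  have : IsDomain B := e.toMulEquiv.isDomain
  have : FaithfulSMul R B := GaAction.faithfulSMul_of_algEquiv_mvPolynomial e
  refine ⟨⟨?_, ?_⟩, fun ⟨q⟩ ↦ ⟨?_, ?_⟩⟩
  · rintro ⟨hret, φ, hφ, hne, hA⟩
    obtain ⟨π⟩ := hret.exists_algHom
    obtain ⟨ψ, hψ⟩ := hφ.exists_injective hA π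
    refine GaAction.isSymOfInvertibleIdeal_of_injective e π ψ hψ ?_
    -- If `A` were all of `B`, every element would be invariant and `φ` would be trivial.
    by_contra! hall
    refine hne (AlgHom.ext fun b ↦ ?_)
    have hb : b ∈ A.toSubring := hall b
    rw [hA] at hb
    exact hb
  · intro h
    obtain ⟨J, j, hJ, hj⟩ := h.exists_isSymmetricAlgebra
    refine ⟨GaAction.isRetract_of_algHom (GaAction.augmentation hj), GaAction.translation hj,
      GaAction.isExponentialMap_translation hj, fun h0 ↦ ?_, ?_⟩
    · obtain ⟨x, hx, hx0⟩ := Submodule.exists_mem_ne_zero_of_ne_bot hJ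
      have h1 : GaAction.symDerivation hj (j ⟨x, hx⟩) = 0 := by
        change (GaAction.translation hj (j ⟨x, hx⟩)).coeff 1 = 0
        rw [h0]
        exact Polynomial.coeff_C_succ
      rw [GaAction.symDerivation_apply] at h1
      exact hx0 (Subtype.ext h1)
    · ext b
      rw [GaAction.mem_invariants_translation_iff hj hJ,
        GaAction.mem_range_algebraMap_subalgebra_iff]
      rfl
  · rintro ⟨hret, D, hD, hne, hA⟩
    obtain ⟨π⟩ := hret.exists_algHom
    obtain ⟨ψ, hψ⟩ := hD.exists_injective hA π q
    refine GaAction.isSymOfInvertibleIdeal_of_injective e π ψ hψ ?_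
    by_contra! hall
    refine hne (Derivation.ext fun b ↦ ?_)
    have hb : b ∈ Subalgebra.toSubmodule A := hall b
    rw [hA] at hb
    exact hb
  · intro h
    obtain ⟨J, j, hJ, hj⟩ := h.exists_isSymmetricAlgebra
    have : CharZero A :=
      charZero_of_injective_ringHom ((algebraMap R A).comp q).injective
    refine ⟨GaAction.isRetract_of_algHom (GaAction.augmentation hj),
      (GaAction.symDerivation hj).restrictScalars R,
      GaAction.exists_iterate_symDerivation_eq_zero hj hJ, fun h0 ↦ ?_, ?_⟩
    · obtain ⟨x, hx, hx0⟩ := Submodule.exists_mem_ne_zero_of_ne_bot hJ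
      have h1 : GaAction.symDerivation hj (j ⟨x, hx⟩) = 0 := DFunLike.congr_fun h0 _
      rw [GaAction.symDerivation_apply] at h1
      exact hx0 (Subtype.ext h1)
    · ext b
      rw [Subalgebra.mem_toSubmodule, ← GaAction.mem_range_algebraMap_subalgebra_iff,
        ← GaAction.symDerivation_eq_zero_iff hj hJ]
      rfl
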